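/- **Setting.** Consider finite two-player zero-sum extensive-form games with chance moves and perfect recall; $S_i$ is the set of information sets of player $i$, $A(s)$ the set of actions at $s$, and $|A|$ the largest number of actions at an information set. A joint strategy $\pi$ is an $\epsilon$-NE if $\min_{\pi'_{-i}} v_i(\pi_i,\pi'_{-i})+\epsilon\ge v_i(\pi)\ge\max_{\pi'_i}v_i(\pi'_i,\pi_{-i})-\epsilon$ for each player $i$. *Regret-Minimizing Double Oracle (RMDO)* with frequency function $m:\mathbb N\to\mathbb N^+$ maintains a population $\Pi_t$, i.e. a nonempty set of actions at each information set; the restricted game $\mathbf G_t$ is the original game in which the players may use only the actions in $\Pi_t$. Initially $\Pi_1$ consists of one pure best response of each player to the uniformly random strategy, and the window index is $j=0$. In iteration $t=1,2,\dots$ one step of a regret minimizer is made in $\mathbf G_t$, which gives a joint strategy $\pi^t$. If $m(j)$ divides $t$, then for each player a pure best response, in the original game, to the average strategy of the current window (the realization-weighted average of the strategies $\pi^{t'}$ played so far in this window, with probability $0$ on actions outside the population) is merged into the population; ties are broken arbitrarily. If the population changes, a new window begins: $j$ increases by one and the regret minimizer is reset. *Periodic Double Oracle (PDO)* is RMDO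 with constant frequency $m\equiv c$, where $c>1$ is an integer. Let $T$ be the first iteration after which the last-window average strategy (the average over the current window) is an $\epsilon$-NE of the original game. Let $k$ be the number of windows (restricted games) up to iteration $T$, and let $X=\sum_i|S_{i,k}|$ be the number of information sets of both players in the restricted game of the last window. The *sample complexity* is the total cost of the iterations $1,\dots,T$, where each step of regret minimization and each best-response computation (for both players together) costs the number of information sets in the current restricted game. **Proposition (PDO sample complexity).** (a) Let the regret minimizer be counterfactual regret minimization (CFR) with regret matching, run for both players simultaneously. For every $\Delta$ there is a constant $C>0$, depending only on $\Delta$, such that for every such game whose terminal payoffs differ by at most $\Delta$, every integer $c>1$ and every $\epsilon>0$, PDO reaches an $\epsilon$-NE after finitely many iterations, and its sample complexity to do so is at most $$C\left(\frac{k|A|X^3}{\epsilon^2}+ckX+\frac{k|A|X^3}{c\,\epsilon^2}\right).$$ (b) More generally, for all $K\in\mathbb R$ and $p\in\mathbb N$ there are $C>0$ and $q\in\mathbb N$, depending only on $K$ and $p$, such that for every such game, every $c>1$ and $\epsilon>0$, and every regret minimizer (a rule that assigns to each restricted game $\Gamma$ a sequence of joint strategies of $\Gamma$) whose regret for each player $i$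 after $n$ iterations in any restricted game $\Gamma$ is at most $K\,|S_i(\Gamma)|\sqrt{|A(\Gamma)|\,n}\,\log^p\!\big(2+|S_i(\Gamma)||A(\Gamma)|n\big)$, where $|S_i(\Gamma)|$ and $|A(\Gamma)|$ are the number of information sets of player $i$ and the largest number of actions in $\Gamma$, PDO with this regret minimizer reaches an $\epsilon$-NE after finitely many iterations, with sample complexity at most $$C\left(\frac{k|A|X^3}{\epsilon^2}+ckX+\frac{k|A|X^3}{c\,\epsilon^2}\right)\log^q\!\big(2+|A|X+1/\epsilon\big).$$ In particular the sample complexity of PDO is $\tilde{\mathcal O}\big(k|A|X^3/\epsilon^2+ckX+k|A|X^3/(c\epsilon^2)\big)$, which is polynomial, and linear in $k$. -/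

import Mathlib

namespace DoubleOracle

/-! Finite two-player zero-sum extensive-form games with chance moves.

The players are `0` and `1`. `S i` is the type of information-set labels of player `i`, and
`A i s` is the type of actions available at the information set `s` of player `i`. -/

/-- Game trees. The nodes are the histories. A terminal history carries the payoff of player `0`
(player `1` gets its negative); a chance node carries the probabilities of its outcomes; all
decision nodes with the same label `s : S i` form one information set of player `i`. -/
inductive Tree {S : Fin 2 → Type*} (A : ∀ i, S i → Type*) where
  | terminal (u : ℝ) : Tree A
  | chance (n : ℕ) (p : Fin n → ℝ) (next : Fin n → Tree A) : Tree A
  | decision (i : Fin 2) (s : S i) (next : A i s → Tree A) : Tree A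

/-- A move of a player: the player, the information set, and the action taken there. -/
abbrev Move {S : Fin 2 → Type*} (A : ∀ i, S i → Type*) := Σ i, Σ s : S i, A i s

namespace Tree

variable {S : Fin 2 → Type*} {A : ∀ i, S i → Type*}

/-- Every chance node carries a probability distribution. -/
def ChanceOK : Tree A → Prop
  | terminal _ => True
  | chance _ p next => (∀ o, 0 ≤ p o) ∧ ∑ o, p o = 1 ∧ ∀ o, ChanceOK (next o)
  | decision _ _ next => ∀ b, ChanceOK (next b)

/-- The payoffs (of player `0`) at the terminal histories. -/
def payoffs : Tree A → Set ℝ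
  | terminal u => {u}
  | chance _ _ next => {u | ∃ o, u ∈ payoffs (next o)}
  | decision _ _ next => {u | ∃ b, u ∈ payoffs (next b)}

/-- The sequences of own moves of player `i` that lead from the root to the histories in the
information set `s` of player `i`. -/
def ownSeqs (i : Fin 2) (s : S i) : Tree A → Set (List (Move A))
  | terminal _ => ∅
  | chance _ _ next => {l | ∃ o, l ∈ ownSeqs i s (next o)}
  | decision j s' next =>
      {l | (l = [] ∧ (⟨j, s'⟩ : Σ i, S i) = ⟨i, s⟩) ∨
        ∃ b, ∃ l' ∈ ownSeqs i s (next b), l = if j = i then ⟨j, s', b⟩ :: l' else l'}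

/-- The information set `s` of player `i` contains some history of the tree. -/
def Occurs (t : Tree A) (i : Fin 2) (s : S i) : Prop := (t.ownSeqs i s).Nonempty

/-- Perfect recall: all histories in an information set of player `i` have the same sequence of
own information sets and actions of player `i`. -/
def PerfectRecall (t : Tree A) : Prop := ∀ i s, (t.ownSeqs i s).Subsingleton

open Classical in
/-- The number of information sets of player `i` in the tree. -/
noncomputable def numInfosets [∀ i, Fintype (S i)] (t : Tree A) (i : Fin 2) : ℕ :=
  (Finset.univ.filter fun s : S i => t.Occurs i s).card

/-- The size of the game: the total number of information sets of both players. -/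
noncomputable def size [∀ i, Fintype (S i)] (t : Tree A) : ℕ := ∑ i, t.numInfosets i

open Classical in
/-- The largest number of actions at an information set of the tree. -/
noncomputable def maxActions [∀ i, Fintype (S i)] [∀ i s, Fintype (A i s)] (t : Tree A) : ℕ :=
  Finset.univ.sup fun x : Σ i, S i => if t.Occurs x.1 x.2 then Fintype.card (A x.1 x.2) else 0

end Tree

/-- A finite two-player zero-sum extensive-form game with perfect recall. -/
structure EFG {S : Fin 2 → Type*} (A : ∀ i, S i → Type*) where
  tree : Tree A
  chanceOK : tree.ChanceOK
  perfectRecall : tree.PerfectRecall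

section Strategies

variable {S : Fin 2 → Type*} {A : ∀ i, S i → Type*} [∀ i s, Fintype (A i s)]

/-- Behaviour strategies of player `i`. -/
abbrev Strategy (A : ∀ i, S i → Type*) [∀ i s, Fintype (A i s)] (i : Fin 2) :=
  ∀ s : S i, stdSimplex ℝ (A i s)

/-- Joint strategies. -/
abbrev Profile (A : ∀ i, S i → Type*) [∀ i s, Fintype (A i s)] := ∀ i, Strategy A i

/-- Expected payoff of player `0` when `σ` is played from the root of the tree. -/
noncomputable def Tree.value (σ : Profile A) : Tree A → ℝ
  | .terminal u => u
  | .chance _ p next => ∑ o, p o * Tree.value σ (next o)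
  | .decision i s next => ∑ b, (σ i s).1 b * Tree.value σ (next b)

/-- Expected payoff of player `i` when `σ` is played from the root of the tree. -/
noncomputable def Tree.valueFor (t : Tree A) (σ : Profile A) (i : Fin 2) : ℝ :=
  if i = 0 then t.value σ else -t.value σ

/-- `σ` is an `ε`-Nash equilibrium: for each player `i`,
`min v_i(σ_i, ·) + ε ≥ v_i(σ) ≥ max v_i(·, σ_{-i}) - ε`. -/
def Tree.IsEpsNash (t : Tree A) (ε : ℝ) (σ : Profile A) : Prop :=
  ∀ i, (∀ j, j ≠ i → ∀ τ : Strategy A j,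
          t.valueFor σ i ≤ t.valueFor (Function.update σ j τ) i + ε) ∧
       (∀ τ : Strategy A i, t.valueFor (Function.update σ i τ) i - ε ≤ t.valueFor σ i)

open Classical in
/-- The pure strategy that plays `b s` at the information set `s`. -/
noncomputable def pureStrategy {i : Fin 2} (b : ∀ s : S i, A i s) : Strategy A i :=
  fun s => ⟨Pi.single (b s) 1, single_mem_stdSimplex ℝ (b s)⟩

/-- `b` is a pure best response of player `i` against `σ_{-i}`. -/
def Tree.IsBestResponse (t : Tree A) (σ : Profile A) (i : Fin 2) (b : ∀ s : S i, A i s) : Prop :=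
  ∀ τ : Strategy A i,
    t.valueFor (Function.update σ i τ) i ≤ t.valueFor (Function.update σ i (pureStrategy b)) i

theorem uniform_mem (α : Type*) [Fintype α] [Nonempty α] :
    (fun _ : α => (1 : ℝ) / Fintype.card α) ∈ stdSimplex ℝ α := by
  refine ⟨fun _ => by positivity, ?_⟩
  have : (Fintype.card α : ℝ) ≠ 0 := by exact_mod_cast Fintype.card_ne_zero
  simp [this]

/-- The uniformly random joint strategy. -/
noncomputable def uniformProfile (A : ∀ i, S i → Type*) [∀ i s, Fintype (A i s)]
    [∀ i s, Nonempty (A i s)] : Profile A :=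
  fun i s => ⟨fun _ => 1 / Fintype.card (A i s), uniform_mem (A i s)⟩

end Strategies

section CFR

variable {S : Fin 2 → Type*} {A : ∀ i, S i → Type*} [∀ i s, Fintype (A i s)]

open Classical in
/-- Instantaneous counterfactual regret
`r_i(s, a) = ∑_{h ∈ s} x_{-i}(h) (v_i(h·a) - v_i(h))`, where `x_{-i}(h)` is the contribution of
chance and of the opponent to the probability of reaching `h`, and `v_i(h)` is the expected payoff
of player `i` when play starts at `h`. -/
noncomputable def Tree.instRegret (σ : Profile A) (i : Fin 2) (s : S i) (a : A i s) : Tree A → ℝ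
  | .terminal _ => 0
  | .chance _ p next => ∑ o, p o * Tree.instRegret σ i s a (next o)
  | .decision j s' next =>
      ∑ b, ((if (⟨j, s', b⟩ : Move A) = ⟨i, s, a⟩ then
              (next b).valueFor σ i - (Tree.decision j s' next).valueFor σ i else 0)
            + (if j = i then 1 else (σ j s').1 b) * Tree.instRegret σ i s a (next b))

open Classical in
/-- Regret matching at one information set: play proportionally to the positive parts of the
cumulative regrets, or uniformly if there is no positive regret. -/
noncomputable def regretMatch {α : Type*} [Fintype α] (R : α → ℝ) : α → ℝ :=
  fun a => if 0 < ∑ b, max 0 (R b) then max 0 (R a) / ∑ b, max 0 (R b)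
    else 1 / Fintype.card α

theorem regretMatch_mem {α : Type*} [Fintype α] [Nonempty α] (R : α → ℝ) :
    regretMatch R ∈ stdSimplex ℝ α := by
  unfold regretMatch
  by_cases h : 0 < ∑ b, max 0 (R b)
  · simp only [h, if_true]
    refine ⟨fun a => div_nonneg (le_max_left _ _) h.le, ?_⟩
    rw [← Finset.sum_div, div_self h.ne']
  · simp only [h, if_false]
    exact uniform_mem α

variable [∀ i s, Nonempty (A i s)]

/-- The joint strategy obtained by regret matching from a table of cumulative regrets. -/
noncomputable def matchProfile (R : ∀ i (s : S i), A i s → ℝ) : Profile A :=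
  fun i s => ⟨regretMatch (R i s), regretMatch_mem (R i s)⟩

/-- Cumulative counterfactual regrets after `n` iterations of counterfactual regret minimization
(both players updated in every iteration). -/
noncomputable def cfrRegret (t : Tree A) : ℕ → ∀ i (s : S i), A i s → ℝ
  | 0 => fun _ _ _ => 0
  | n + 1 => fun i s a => cfrRegret t n i s a + t.instRegret (matchProfile (cfrRegret t n)) i s a

/-- The joint strategy played by counterfactual regret minimization in the game `t` after `n`
earlier iterations. For `n = 0` it is uniformly random. -/
noncomputable def cfrIterate (t : Tree A) (n : ℕ) : Profile A := matchProfile (cfrRegret t n)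

end CFR

section Restricted

variable {S : Fin 2 → Type*} {A : ∀ i, S i → Type*}

/-- A population: a nonempty set of available actions at every information set. -/
@[ext] structure Population (A : ∀ i, S i → Type*) where
  acts : ∀ i (s : S i), Finset (A i s)
  nonempty : ∀ i s, (acts i s).Nonempty

namespace Population

/-- The actions available at `s` in the restricted game. -/
abbrev Act (P : Population A) (i : Fin 2) (s : S i) := {a : A i s // a ∈ P.acts i s}

instance instNonemptyAct (P : Population A) (i : Fin 2) (s : S i) : Nonempty (P.Act i s) :=
  (P.nonempty i s).to_subtype

/-- The population that consists of one pure strategy of each player. -/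
def single (b : ∀ i (s : S i), A i s) : Population A where
  acts i s := {b i s}
  nonempty _ _ := Finset.singleton_nonempty _

open Classical in
/-- Merge one pure strategy of each player into the population. -/
noncomputable def merge (P : Population A) (b : ∀ i (s : S i), A i s) : Population A where
  acts i s := P.acts i s ∪ {b i s}
  nonempty i s := (P.nonempty i s).mono Finset.subset_union_left

/-- The restricted game: the players may use only the actions in the population. -/
def restrict (P : Population A) : Tree A → Tree P.Act
  | .terminal u => .terminal u
  | .chance n p next => .chance n p fun o => restrict P (next o)
  | .decision i s next => .decision i s fun b => restrict P (next b.1)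

open Classical in
/-- Extension of a joint strategy of the restricted game to the original game: actions outside the
population get probability zero. -/
noncomputable def extend [∀ i s, Fintype (A i s)] (P : Population A) (σ : Profile P.Act) :
    Profile A :=
  fun i s => ⟨fun a => if h : a ∈ P.acts i s then (σ i s).1 ⟨a, h⟩ else 0, by
    refine ⟨fun a => ?_, ?_⟩
    · by_cases h : a ∈ P.acts i s
      · simpa [h] using (σ i s).2.1 ⟨a, h⟩
      · simp [h]
    · rw [← (σ i s).2.2, ← Finset.sum_subset (Finset.subset_univ (P.acts i s))
        (fun a _ h => by simp [h]), ← Finset.sum_coe_sort (P.acts i s)]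
      exact Finset.sum_congr rfl fun a _ => by simp⟩

end Population

end Restricted

section Average

variable {S : Fin 2 → Type*} {A : ∀ i, S i → Type*} [∀ i s, Fintype (A i s)]

open Classical in
/-- The contribution of player `i` to the probability of reaching the information set `s`, i.e. the
product of the probabilities of the own moves that lead to `s`. -/
noncomputable def Tree.ownReach (t : Tree A) (σ : Profile A) (i : Fin 2) (s : S i) : ℝ :=
  if h : t.Occurs i s then (h.some.map fun x => (σ x.1 x.2.1).1 x.2.2).prod else 1

theorem Tree.ownReach_nonneg (t : Tree A) (σ : Profile A) (i : Fin 2) (s : S i) :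
    0 ≤ t.ownReach σ i s := by
  unfold Tree.ownReach
  split_ifs with h
  · refine List.prod_nonneg fun x hx => ?_
    obtain ⟨y, -, rfl⟩ := List.mem_map.1 hx
    exact (σ y.1 y.2.1).2.1 y.2.2
  · exact zero_le_one

open Classical in
/-- The weights of the strategies `σ 0, …, σ n` in their average at `s`: the reaching
probabilities, or equal weights if `s` is reached by none of them. -/
noncomputable def Tree.avgWeight (t : Tree A) (σ : ℕ → Profile A) (n : ℕ) (i : Fin 2) (s : S i)
    (r : ℕ) : ℝ :=
  if 0 < ∑ r ∈ Finset.range (n + 1), t.ownReach (σ r) i s then t.ownReach (σ r) i s else 1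

/-- The average strategy of `σ 0, …, σ n`, i.e. the behaviour strategy that is equivalent to
choosing one of the `n + 1` strategies uniformly at random before the game starts. -/
noncomputable def Tree.average (t : Tree A) (σ : ℕ → Profile A) (n : ℕ) : Profile A :=
  fun i s => ⟨(Finset.range (n + 1)).centerMass (t.avgWeight σ n i s) fun r => (σ r i s).1, by
    refine (convex_stdSimplex ℝ (A i s)).centerMass_mem (fun r _ => ?_) ?_ fun r _ => (σ r i s).2
    · unfold Tree.avgWeight
      split_ifs
      · exact t.ownReach_nonneg _ i s
      · exact zero_le_one
    · unfold Tree.avgWeight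
      split_ifs with h
      · exact h
      · simp; positivity⟩

end Average

section RMDO

variable {S : Fin 2 → Type*} {A : ∀ i, S i → Type*} [∀ i s, Fintype (A i s)]

/-- A regret minimizer for the restricted games of a game: `alg P n` is the joint strategy that it
plays in the restricted game with population `P` after `n` earlier iterations since its last
reset. -/
abbrev Minimizer (A : ∀ i, S i → Type*) [∀ i s, Fintype (A i s)] :=
  ∀ P : Population A, ℕ → Profile P.Act

/-- Counterfactual regret minimization with regret matching, run in the restricted game. -/
noncomputable def cfr (G : EFG A) : Minimizer A := fun P n => cfrIterate (P.restrict G.tree) n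

/-- The regret of both players after `n` iterations in any restricted game `Γ` is
`O(|S_i(Γ)| √(|A(Γ)| n))` up to logarithmic factors, with constant `K` and exponent `p`. -/
def HasRegretRate [∀ i, Fintype (S i)] (G : EFG A) (alg : Minimizer A) (K : ℝ) (p : ℕ) : Prop :=
  ∀ (P : Population A) (i : Fin 2) (n : ℕ) (τ : Strategy P.Act i),
    ∑ r ∈ Finset.range n, ((P.restrict G.tree).valueFor (Function.update (alg P r) i τ) i
        - (P.restrict G.tree).valueFor (alg P r) i)
      ≤ K * ((P.restrict G.tree).numInfosets i * √((P.restrict G.tree).maxActions * n))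
        * Real.log (2 + (P.restrict G.tree).numInfosets i * (P.restrict G.tree).maxActions * n) ^ p

/-- A selection of pure best responses in the original game. The selection among several best
responses may depend on the iteration. -/
structure BestResponder (G : EFG A) where
  br : ℕ → Profile A → ∀ i (s : S i), A i s
  isBestResponse : ∀ t σ i, G.tree.IsBestResponse σ i (br t σ i)

/-- The data of the algorithm at the start of an iteration: the current population, the index `j`
of the current time window, and the number of earlier iterations in that window. -/
structure RunState (A : ∀ i, S i → Type*) where
  pop : Population A
  window : ℕ
  done : ℕ

/-- The average of the strategies played in the current window up to and including the current
iteration, extended to the original game. -/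
noncomputable def RunState.average (G : EFG A) (alg : Minimizer A) (x : RunState A) : Profile A :=
  G.tree.average (fun r => x.pop.extend (alg x.pop r)) x.done

variable [∀ i s, Nonempty (A i s)]

open Classical in
/-- Regret-Minimizing Double Oracle with frequency function `m`: the state at the start of iteration
`t`. Iterations are numbered from `1`; the value at `0` is a copy of the value at `1`. In iteration
`t`, one step of regret minimization is made in the restricted game; if `m j` divides `t`, best
responses in the original game to the current-window average strategy are merged into the
population; if the population changes, a new window starts and the regret minimizer is reset. -/
noncomputable def rmdo (G : EFG A) (alg : Minimizer A) (β : BestResponder G) (m : ℕ → ℕ+) :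
    ℕ → RunState A
  | 0 => ⟨.single (β.br 0 (uniformProfile A)), 0, 0⟩
  | 1 => ⟨.single (β.br 0 (uniformProfile A)), 0, 0⟩
  | t + 2 =>
      let x := rmdo G alg β m (t + 1)
      if (t + 1) % (m x.window : ℕ) = 0 ∧
          x.pop.merge (β.br (t + 1) (x.average G alg)) ≠ x.pop then
        ⟨x.pop.merge (β.br (t + 1) (x.average G alg)), x.window + 1, 0⟩
      else ⟨x.pop, x.window, x.done + 1⟩

/-- The last-window average strategy after iteration `t`. -/
noncomputable def lastWindowAverage (G : EFG A) (alg : Minimizer A) (β : BestResponder G)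
    (m : ℕ → ℕ+) (t : ℕ) : Profile A :=
  (rmdo G alg β m t).average G alg

/-- `T` is the first iteration after which the last-window average strategy is an `ε`-Nash
equilibrium of the original game. -/
def FirstReaches (G : EFG A) (alg : Minimizer A) (β : BestResponder G) (m : ℕ → ℕ+) (ε : ℝ)
    (T : ℕ) : Prop :=
  IsLeast {t | 1 ≤ t ∧ G.tree.IsEpsNash ε (lastWindowAverage G alg β m t)} T

/-- The number `k` of time windows (restricted games) in the iterations `1, …, T`. -/
noncomputable def numWindows (G : EFG A) (alg : Minimizer A) (β : BestResponder G) (m : ℕ → ℕ+)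
    (T : ℕ) : ℕ :=
  (rmdo G alg β m T).window + 1

variable [∀ i, Fintype (S i)]

/-- The number of information sets in the restricted game of iteration `t`. -/
noncomputable def gameSize (G : EFG A) (alg : Minimizer A) (β : BestResponder G) (m : ℕ → ℕ+)
    (t : ℕ) : ℕ :=
  ((rmdo G alg β m t).pop.restrict G.tree).size

/-- The number of samples used in the iterations `1, …, T`. An iteration of regret minimization and
a computation of best responses each cost the number of information sets in the current restricted
game; the latter takes place in the iterations `t` that are divisible by `m j`. -/
noncomputable def samples (G : EFG A) (alg : Minimizer A) (β : BestResponder G) (m : ℕ → ℕ+)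
    (T : ℕ) : ℕ :=
  ∑ t ∈ Finset.Icc 1 T, gameSize G alg β m t +
    ∑ t ∈ (Finset.Icc 1 T).filter (fun t => t % (m (rmdo G alg β m t).window : ℕ) = 0),
      gameSize G alg β m t

end RMDO

/-- The frequency function of Periodic Double Oracle, which is Regret-Minimizing Double Oracle with
a constant frequency. -/
def periodic (c : ℕ+) : ℕ → ℕ+ := fun _ => c

end DoubleOracle

/-!
Once a best-response computation leaves the population unchanged, the best responses to the window
average already belong to the restricted game. By perfect recall a fixed strategy earns against the
average the mean of what it earns against the averaged strategies (`Tree.valueFor_average`), so after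
`n` iterations of the window the gains of the two players from best responses add up to at most the
sum of their regrets in the restricted game divided by `n`, and the average is an `ε`-equilibrium as
soon as this is at most `ε` (`isEpsNash_average`). With regret of order `X √(N n)` up to logarithms,
where `X` is the size of the restricted game and `N` the largest number of actions, this holds when
`n` exceeds a threshold `n₀` of order `X² N / ε²` up to logarithms (`exists_threshold`).

Before an `ε`-equilibrium is found, a window therefore ends at the latest at the first
best-response computation after `n₀` iterations, that is within `n₀ + c` iterations, and `k` windows
have at most `k (n₀ + c)` iterations (`iterations_le`). Each new window enlarges the population, so
there are finitely many windows. Restricted games only grow, so every iteration costs at most the size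
`X` of the last one, and one iteration in `c` pays this a second time for the best responses. This
gives the stated sum (`exists_samples_le`).

For counterfactual regret minimization it remains to bound the regret (`hasRegretRate_cfr`). The gain
of a deviation is the sum over the information sets of the counterfactual regrets, weighted with the
deviator's own probability of reaching them (`Tree.mul_valueFor_update_sub`). By perfect recall the
instantaneous regrets are at most the payoff range `Δ` (`Tree.instRegret_mem_Icc`), and the potential
argument for regret matching bounds each cumulative regret by `Δ √(N n)`
(`regret_le_of_regretMatch`). This rate has no logarithm, and neither has the resulting bound.
-/

namespace DoubleOracle

/-! ### Values of game trees -/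

namespace Tree

theorem payoffs_nonempty {S : Fin 2 → Type*} {A : ∀ i, S i → Type*} [∀ i s, Nonempty (A i s)] :
    ∀ t : Tree A, t.ChanceOK → t.payoffs.Nonempty
  | .terminal u, _ => ⟨u, rfl⟩
  | .chance n p next, ht => by
    obtain ⟨o⟩ : Nonempty (Fin n) := by
      by_contra h
      have h1 := ht.2.1
      rw [not_nonempty_iff] at h
      simp at h1
    obtain ⟨u, hu⟩ := payoffs_nonempty (next o) (ht.2.2 o)
    exact ⟨u, o, hu⟩
  | .decision i s next, ht => by
    obtain ⟨b⟩ : Nonempty (A i s) := inferInstance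
    obtain ⟨u, hu⟩ := payoffs_nonempty (next b) (ht b)
    exact ⟨u, b, hu⟩

section Values

variable {S : Fin 2 → Type*} {A : ∀ i, S i → Type*} [∀ i s, Fintype (A i s)]

theorem valueFor_chance (σ : Profile A) (i : Fin 2) {n : ℕ} (p : Fin n → ℝ)
    (next : Fin n → Tree A) :
    (chance n p next).valueFor σ i = ∑ o, p o * (next o).valueFor σ i := by
  unfold valueFor
  split_ifs <;> simp [value]

theorem valueFor_decision (σ : Profile A) (i j : Fin 2) (s : S j) (next : A j s → Tree A) :
    (decision j s next).valueFor σ i = ∑ b, (σ j s).1 b * (next b).valueFor σ i := by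
  unfold valueFor
  split_ifs <;> simp [value]

theorem value_mem_Icc {lo hi : ℝ} (σ : Profile A) :
    ∀ t : Tree A, t.ChanceOK → t.payoffs ⊆ Set.Icc lo hi → t.value σ ∈ Set.Icc lo hi
  | .terminal _, _, hp => hp rfl
  | .chance _ _ next, ht, hp =>
      (convex_Icc lo hi).sum_mem (fun o _ => ht.1 o) ht.2.1 fun o _ =>
        value_mem_Icc σ (next o) (ht.2.2 o) fun _ hu => hp ⟨o, hu⟩
  | .decision i s next, ht, hp =>
      (convex_Icc lo hi).sum_mem (fun b _ => (σ i s).2.1 b) (σ i s).2.2 fun b _ =>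
        value_mem_Icc σ (next b) (ht b) fun _ hu => hp ⟨b, hu⟩

theorem abs_valueFor_sub_le {lo D : ℝ} (σ : Profile A) (i : Fin 2) {t t' : Tree A}
    (ht : t.ChanceOK) (hp : t.payoffs ⊆ Set.Icc lo (lo + D))
    (ht' : t'.ChanceOK) (hp' : t'.payoffs ⊆ Set.Icc lo (lo + D)) :
    |t.valueFor σ i - t'.valueFor σ i| ≤ D := by
  have h := value_mem_Icc σ t ht hp
  have h' := value_mem_Icc σ t' ht' hp'
  unfold valueFor
  rw [abs_le]
  split_ifs <;> constructor <;> linarith [h.1, h.2, h'.1, h'.2]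

end Values

/-! ### Information sets and own sequences -/

section Infosets

variable {S : Fin 2 → Type*} {A : ∀ i, S i → Type*}

theorem occurs_chance {i : Fin 2} {s : S i} {n : ℕ} {p : Fin n → ℝ} {next : Fin n → Tree A} :
    (chance n p next).Occurs i s ↔ ∃ o, (next o).Occurs i s := by
  simp only [Occurs, ownSeqs, Set.Nonempty, Set.mem_ofPred_eq]
  exact exists_comm

theorem occurs_decision {i j : Fin 2} {s : S i} {s' : S j} {next : A j s' → Tree A} :
    (decision j s' next).Occurs i s ↔
      (⟨j, s'⟩ : Σ i, S i) = ⟨i, s⟩ ∨ ∃ b, (next b).Occurs i s := by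
  constructor
  · rintro ⟨l, ⟨-, h⟩ | ⟨b, l', h, -⟩⟩
    · exact Or.inl h
    · exact Or.inr ⟨b, l', h⟩
  · rintro (h | ⟨b, l', h⟩)
    · exact ⟨[], Or.inl ⟨rfl, h⟩⟩
    · exact ⟨_, Or.inr ⟨b, l', h, rfl⟩⟩

theorem card_le_maxActions [∀ i, Fintype (S i)] [∀ i s, Fintype (A i s)] {t : Tree A} {i : Fin 2}
    {s : S i} (h : t.Occurs i s) : Fintype.card (A i s) ≤ t.maxActions := by
  classical
  refine le_trans ?_ (Finset.le_sup (Finset.mem_univ (⟨i, s⟩ : Σ i, S i)))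
  simp [h]

variable [∀ i s, Fintype (A i s)]

theorem ownReach_eq {t : Tree A} (ht : t.PerfectRecall) (σ : Profile A) {i : Fin 2} {s : S i}
    {l : List (Move A)} (hl : l ∈ t.ownSeqs i s) :
    (l.map fun x => (σ x.1 x.2.1).1 x.2.2).prod = t.ownReach σ i s := by
  have h : t.Occurs i s := ⟨l, hl⟩
  rw [ownReach, dif_pos h, ht i s hl h.some_mem]

theorem ownReach_le_one (t : Tree A) (σ : Profile A) (i : Fin 2) (s : S i) :
    t.ownReach σ i s ≤ 1 := by
  unfold ownReach
  split_ifs with h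
  · generalize h.some = l
    induction l with
    | nil => simp
    | cons x l ih =>
      rw [List.map_cons, List.prod_cons]
      refine mul_le_one₀ (mem_Icc_of_mem_stdSimplex (σ x.1 x.2.1).2 x.2.2).2
        (List.prod_nonneg fun y hy => ?_) ih
      obtain ⟨z, -, rfl⟩ := List.mem_map.1 hy
      exact (σ z.1 z.2.1).2.1 z.2.2
  · exact le_rfl

end Infosets

/-! ### The average strategy -/

section Average

variable {S : Fin 2 → Type*} {A : ∀ i, S i → Type*} [∀ i s, Fintype (A i s)]

theorem sum_ownReach_mul_average (t : Tree A) (σ : ℕ → Profile A) (n : ℕ) (j : Fin 2) (s : S j)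
    (b : A j s) :
    (∑ r ∈ Finset.range (n + 1), t.ownReach (σ r) j s) * (t.average σ n j s).1 b =
      ∑ r ∈ Finset.range (n + 1), t.ownReach (σ r) j s * (σ r j s).1 b := by
  by_cases h : 0 < ∑ r ∈ Finset.range (n + 1), t.ownReach (σ r) j s
  · simp only [average, avgWeight, Finset.centerMass, h, if_true, Pi.smul_apply, Finset.sum_apply,
      smul_eq_mul]
    rw [mul_inv_cancel_left₀ h.ne']
  · have h0 : ∑ r ∈ Finset.range (n + 1), t.ownReach (σ r) j s = 0 :=
      le_antisymm (not_lt.1 h) (Finset.sum_nonneg fun r _ => t.ownReach_nonneg _ _ _)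
    have h1 := (Finset.sum_eq_zero_iff_of_nonneg
      fun r _ => t.ownReach_nonneg (σ r) j s).1 h0
    rw [h0, zero_mul, Finset.sum_eq_zero]
    intro r hr
    rw [h1 r hr, zero_mul]

/-- Realization equivalence below a node: `w r` is the probability that the own moves of player `j`
under `σ r` lead to the subtree `t'` of `t`, and the opponent's strategy is the same throughout. -/
theorem sum_mul_value_average (t : Tree A) (σ : ℕ → Profile A) (n : ℕ) (j : Fin 2)
    (ρ : ℕ → Profile A) (ρ' : Profile A) (hρ : ∀ r, ρ r j = σ r j) (hρ' : ρ' j = t.average σ n j)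
    (h : ∀ r i, i ≠ j → ρ r i = ρ' i) (t' : Tree A) :
    ∀ w : ℕ → ℝ, (∀ s, ∀ l ∈ t'.ownSeqs j s, ∀ r,
        w r * (l.map fun y => (σ r y.1 y.2.1).1 y.2.2).prod = t.ownReach (σ r) j s) →
      (∑ r ∈ Finset.range (n + 1), w r) * t'.value ρ' =
        ∑ r ∈ Finset.range (n + 1), w r * t'.value (ρ r) := by
  induction t' with
  | terminal u => intro w _; simp [value, Finset.sum_mul]
  | chance m p next ih =>
    intro w hw
    have := fun o => ih o w fun s l hl => hw s l ⟨o, hl⟩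
    simp only [value, Finset.mul_sum]
    rw [Finset.sum_comm]
    refine Finset.sum_congr rfl fun o _ => ?_
    rw [mul_left_comm, this o, Finset.mul_sum]
    exact Finset.sum_congr rfl fun r _ => by ring
  | decision i s next ih =>
    intro w hw
    simp only [value, Finset.mul_sum]
    rw [Finset.sum_comm]
    refine Finset.sum_congr rfl fun b _ => ?_
    by_cases hi : i = j
    · subst hi
      have hws : ∀ r, w r = t.ownReach (σ r) i s := fun r => by
        simpa using hw s [] (Or.inl ⟨rfl, rfl⟩) r
      have h1 := ih b (fun r => w r * (σ r i s).1 b) fun s' l hl r => by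
        rw [← hw s' (⟨i, s, b⟩ :: l) (Or.inr ⟨b, l, hl, by simp⟩) r]
        simp [mul_assoc]
      have h2 := sum_ownReach_mul_average t σ n i s b
      simp only [← hws] at h2
      rw [hρ', ← mul_assoc, h2, h1]
      exact Finset.sum_congr rfl fun r _ => by rw [hρ, mul_assoc]
    · have h1 := ih b w fun s' l hl r => hw s' l (Or.inr ⟨b, l, hl, by simp [hi]⟩) r
      rw [mul_left_comm, h1, Finset.mul_sum]
      exact Finset.sum_congr rfl fun r _ => by rw [h r i hi]; ring

/-- Against a fixed strategy of one player, the average strategy of the opponent earns the mean of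
the values that the averaged strategies earn. -/
theorem valueFor_average {t : Tree A} (ht : t.PerfectRecall) (σ : ℕ → Profile A) (n : ℕ)
    (i k : Fin 2) (τ : Strategy A i) :
    (n + 1) * t.valueFor (Function.update (t.average σ n) i τ) k =
      ∑ r ∈ Finset.range (n + 1), t.valueFor (Function.update (σ r) i τ) k := by
  obtain ⟨j, hj⟩ : ∃ j : Fin 2, j ≠ i := exists_ne i
  have key := sum_mul_value_average t σ n j (fun r => Function.update (σ r) i τ)
    (Function.update (t.average σ n) i τ) (fun r => by simp [hj]) (by simp [hj])
    (fun r i' hi' => by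
      obtain rfl : i' = i := by omega
      simp) t (fun _ => 1)
    (fun s l hl r => by rw [one_mul, ownReach_eq ht (σ r) hl])
  simp only [one_mul, Finset.sum_const, Finset.card_range, nsmul_eq_mul, mul_one] at key
  push_cast at key
  unfold valueFor
  split_ifs
  · exact key
  · rw [mul_neg, key, Finset.sum_neg_distrib]

end Average

end Tree

/-! ### Restricted games -/

namespace Population

variable {S : Fin 2 → Type*} {A : ∀ i, S i → Type*}

/-- A move of a restricted game, as a move of the original game. -/
def toMove (P : Population A) (x : Move P.Act) : Move A := ⟨x.1, x.2.1, x.2.2.1⟩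

theorem toMove_injective (P : Population A) : Function.Injective P.toMove := by
  rintro ⟨i, s, a, ha⟩ ⟨i', s', a', ha'⟩ h
  simp only [toMove, Sigma.mk.injEq] at h
  obtain ⟨rfl, h⟩ := h
  simp only [heq_eq_eq, Sigma.mk.injEq] at h
  obtain ⟨rfl, h⟩ := h
  simp only [heq_eq_eq] at h
  subst h
  rfl

theorem map_toMove_mem_ownSeqs (P : Population A) (i : Fin 2) (s : S i) (t : Tree A) :
    ∀ l ∈ (P.restrict t).ownSeqs i s, l.map P.toMove ∈ t.ownSeqs i s := by
  induction t with
  | terminal u => exact fun l hl => hl.elim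
  | chance n p next ih => exact fun l ⟨o, hl⟩ => ⟨o, ih o l hl⟩
  | decision j s' next ih =>
    rintro l (⟨rfl, h⟩ | ⟨b, l', hl', rfl⟩)
    · exact Or.inl ⟨rfl, h⟩
    · refine Or.inr ⟨b.1, _, ih b.1 l' hl', ?_⟩
      split_ifs <;> rfl

theorem perfectRecall_restrict (P : Population A) {t : Tree A} (ht : t.PerfectRecall) :
    (P.restrict t).PerfectRecall := fun i s _ hl _ hl' =>
  List.map_injective_iff.2 P.toMove_injective <|
    ht i s (P.map_toMove_mem_ownSeqs i s t _ hl) (P.map_toMove_mem_ownSeqs i s t _ hl')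

theorem chanceOK_restrict (P : Population A) :
    ∀ t : Tree A, t.ChanceOK → (P.restrict t).ChanceOK
  | .terminal _, _ => trivial
  | .chance _ _ next, h => ⟨h.1, h.2.1, fun o => chanceOK_restrict P (next o) (h.2.2 o)⟩
  | .decision _ _ next, h => fun b => chanceOK_restrict P (next b.1) (h b.1)

theorem payoffs_restrict_subset (P : Population A) :
    ∀ t : Tree A, (P.restrict t).payoffs ⊆ t.payoffs
  | .terminal _ => fun _ h => h
  | .chance _ _ next => fun _ ⟨o, h⟩ => ⟨o, payoffs_restrict_subset P (next o) h⟩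
  | .decision _ _ next => fun _ ⟨b, h⟩ => ⟨b.1, payoffs_restrict_subset P (next b.1) h⟩

theorem occurs_of_restrict {P : Population A} {t : Tree A} {i : Fin 2} {s : S i}
    (h : (P.restrict t).Occurs i s) : t.Occurs i s :=
  h.elim fun _ hl => ⟨_, P.map_toMove_mem_ownSeqs i s t _ hl⟩

theorem occurs_restrict_mono {P Q : Population A} (hPQ : ∀ i s, P.acts i s ⊆ Q.acts i s)
    {i : Fin 2} {s : S i} (t : Tree A) :
    (P.restrict t).Occurs i s → (Q.restrict t).Occurs i s := by
  induction t with
  | terminal u => exact fun ⟨_, hl⟩ => hl.elim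
  | chance n p next ih =>
    simp only [restrict, Tree.occurs_chance]
    exact fun ⟨o, h⟩ => ⟨o, ih o h⟩
  | decision j s' next ih =>
    simp only [restrict, Tree.occurs_decision]
    rintro (h | ⟨b, h⟩)
    · exact Or.inl h
    · exact Or.inr ⟨⟨b.1, hPQ _ _ b.2⟩, ih b.1 h⟩

section Size

variable [∀ i, Fintype (S i)]

theorem numInfosets_restrict_le (P : Population A) (t : Tree A) (i : Fin 2) :
    (P.restrict t).numInfosets i ≤ t.numInfosets i := by
  classical
  exact Finset.card_le_card <| Finset.monotone_filter_right _ fun _ _ h => occurs_of_restrict h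

theorem size_restrict_le (P : Population A) (t : Tree A) : (P.restrict t).size ≤ t.size :=
  Finset.sum_le_sum fun i _ => P.numInfosets_restrict_le t i

theorem size_restrict_mono {P Q : Population A} (hPQ : ∀ i s, P.acts i s ⊆ Q.acts i s)
    (t : Tree A) : (P.restrict t).size ≤ (Q.restrict t).size := by
  classical
  exact Finset.sum_le_sum fun _ _ => Finset.card_le_card <|
    Finset.monotone_filter_right _ fun _ _ h => occurs_restrict_mono hPQ t h

theorem maxActions_restrict_le [∀ i s, Fintype (A i s)] (P : Population A) (t : Tree A) :
    (P.restrict t).maxActions ≤ t.maxActions := by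
  classical
  refine Finset.sup_le fun x _ => ?_
  split_ifs with h
  · exact (Fintype.card_subtype_le _).trans (Tree.card_le_maxActions (occurs_of_restrict h))
  · exact Nat.zero_le _

end Size

section Extend

variable [∀ i s, Fintype (A i s)]

theorem value_restrict (P : Population A) (σ : Profile P.Act) (t : Tree A) :
    (P.restrict t).value σ = t.value (P.extend σ) := by
  induction t with
  | terminal u => rfl
  | chance n p next ih => simp only [restrict, Tree.value, ih]
  | decision i s next ih =>
    simp only [restrict, Tree.value, ih]
    rw [← Finset.sum_subset (Finset.subset_univ (P.acts i s))
      (fun a _ h => by simp [extend, h]), ← Finset.sum_coe_sort (P.acts i s)]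
    exact Finset.sum_congr rfl fun a _ => by simp [extend]

theorem valueFor_restrict (P : Population A) (σ : Profile P.Act) (t : Tree A) (i : Fin 2) :
    (P.restrict t).valueFor σ i = t.valueFor (P.extend σ) i := by
  simp only [Tree.valueFor, value_restrict]

theorem extend_update_pureStrategy (P : Population A) (σ : Profile P.Act) (i : Fin 2)
    (b : ∀ s : S i, A i s) (hb : ∀ s, b s ∈ P.acts i s) :
    P.extend (Function.update σ i (pureStrategy fun s => ⟨b s, hb s⟩)) =
      Function.update (P.extend σ) i (pureStrategy b) := by
  classical
  funext j s
  apply Subtype.ext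
  funext a
  by_cases hj : j = i
  · subst hj
    by_cases ha : a ∈ P.acts j s
    · simp only [extend, pureStrategy, Function.update_self, ha, dif_pos, Pi.single_apply,
        Subtype.mk.injEq]
    · have : a ≠ b s := fun h => ha (h ▸ hb s)
      simp [extend, pureStrategy, ha, this]
  · simp [extend, hj]

end Extend

end Population

/-! ### Regret matching -/

/-- The potential argument: regret matching makes `r n` orthogonal to the positive parts of the
regrets `R n`, so the sum of their squares grows by at most `∑ a, r n a ^ 2` in each step. -/
theorem sum_max_sq_le {α : Type*} [Fintype α] {R r : ℕ → α → ℝ} {D : ℝ} (h0 : R 0 = 0)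
    (hR : ∀ n, R (n + 1) = R n + r n) (hr : ∀ n, ∑ a, regretMatch (R n) a * r n a = 0)
    (hD : ∀ n a, |r n a| ≤ D) (n : ℕ) :
    ∑ a, max 0 (R n a) ^ 2 ≤ n * (Fintype.card α * D ^ 2) := by
  induction n with
  | zero => simp [h0]
  | succ n ih =>
    have horth : ∑ a, max 0 (R n a) * r n a = 0 := by
      by_cases h : 0 < ∑ b, max 0 (R n b)
      · have h1 := hr n
        simp only [regretMatch, h, if_true, div_mul_eq_mul_div] at h1
        rw [← Finset.sum_div, div_eq_zero_iff] at h1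
        exact h1.resolve_right h.ne'
      · have hz := (Finset.sum_eq_zero_iff_of_nonneg fun b _ => le_max_left 0 (R n b)).1
          (le_antisymm (not_lt.1 h) (Finset.sum_nonneg fun b _ => le_max_left 0 (R n b)))
        exact Finset.sum_eq_zero fun a ha => by rw [hz a ha, zero_mul]
    have hstep : ∀ a, max 0 (R (n + 1) a) ^ 2 ≤
        max 0 (R n a) ^ 2 + 2 * (max 0 (R n a) * r n a) + D ^ 2 := fun a => by
      have hsq : r n a ^ 2 ≤ D ^ 2 := sq_le_sq' (abs_le.1 (hD n a)).1 (abs_le.1 (hD n a)).2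
      have hle : max 0 (R (n + 1) a) ≤ |max 0 (R n a) + r n a| := by
        rw [hR]
        exact max_le (abs_nonneg _)
          (le_trans (by simp) (le_abs_self _))
      have := pow_le_pow_left₀ (le_max_left 0 (R (n + 1) a)) hle 2
      rw [sq_abs] at this
      nlinarith
    calc ∑ a, max 0 (R (n + 1) a) ^ 2
        ≤ ∑ a, (max 0 (R n a) ^ 2 + 2 * (max 0 (R n a) * r n a) + D ^ 2) :=
          Finset.sum_le_sum fun a _ => hstep a
      _ = ∑ a, max 0 (R n a) ^ 2 + Fintype.card α * D ^ 2 := by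
          rw [Finset.sum_add_distrib, Finset.sum_add_distrib, ← Finset.mul_sum, horth]
          simp
      _ ≤ (n + 1 : ℕ) * (Fintype.card α * D ^ 2) := by push_cast; linarith

theorem regret_le_of_regretMatch {α : Type*} [Fintype α] {R r : ℕ → α → ℝ} {D : ℝ} (h0 : R 0 = 0)
    (hR : ∀ n, R (n + 1) = R n + r n) (hr : ∀ n, ∑ a, regretMatch (R n) a * r n a = 0)
    (hD : ∀ n a, |r n a| ≤ D) (n : ℕ) (a : α) : R n a ≤ D * √(Fintype.card α * n) := by
  have hD0 : 0 ≤ D := (abs_nonneg _).trans (hD 0 a)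
  refine (le_max_right 0 _).trans (le_of_sq_le_sq ?_ (by positivity))
  rw [mul_pow, Real.sq_sqrt (by positivity)]
  calc max 0 (R n a) ^ 2 ≤ ∑ a, max 0 (R n a) ^ 2 :=
        Finset.single_le_sum (f := fun a => max 0 (R n a) ^ 2) (fun _ _ => sq_nonneg _)
          (Finset.mem_univ a)
    _ ≤ n * (Fintype.card α * D ^ 2) := sum_max_sq_le h0 hR hr hD n
    _ = D ^ 2 * (Fintype.card α * n) := by ring

/-! ### Counterfactual regrets -/

section CFR

variable {S : Fin 2 → Type*} {A : ∀ i, S i → Type*} [∀ i s, Fintype (A i s)]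

namespace Tree

theorem instRegret_decision_of_ne (σ : Profile A) {i j : Fin 2} (s : S i) (a : A i s) (s' : S j)
    (next : A j s' → Tree A) (h : j ≠ i) :
    (decision j s' next).instRegret σ i s a =
      ∑ b, (σ j s').1 b * (next b).instRegret σ i s a := by
  simp [instRegret, h]

theorem instRegret_decision_of_infoset_ne (σ : Profile A) {i : Fin 2} (s : S i) (a : A i s)
    (s' : S i) (next : A i s' → Tree A) (h : s' ≠ s) :
    (decision i s' next).instRegret σ i s a = ∑ b, (next b).instRegret σ i s a := by
  simp [instRegret, h]

theorem instRegret_decision_self (σ : Profile A) {i : Fin 2} (s : S i) (a : A i s)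
    (next : A i s → Tree A) :
    (decision i s next).instRegret σ i s a =
      ((next a).valueFor σ i - (decision i s next).valueFor σ i) +
        ∑ b, (next b).instRegret σ i s a := by
  classical
  simp [instRegret, Finset.sum_add_distrib]

theorem instRegret_eq_zero (σ : Profile A) {i : Fin 2} {s : S i} (a : A i s) (t : Tree A) :
    ¬ t.Occurs i s → t.instRegret σ i s a = 0 := by
  induction t with
  | terminal u => exact fun _ => rfl
  | chance n p next ih =>
    intro h
    simp only [occurs_chance, not_exists] at h
    exact Finset.sum_eq_zero fun o _ => by rw [ih o (h o), mul_zero]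
  | decision j s' next ih =>
    intro h
    simp only [occurs_decision, not_or, not_exists] at h
    by_cases hj : j = i
    · subst hj
      rw [instRegret_decision_of_infoset_ne _ _ _ _ _ fun hs => h.1 (by rw [hs])]
      exact Finset.sum_eq_zero fun b _ => ih b (h.2 b)
    · rw [instRegret_decision_of_ne _ _ _ _ _ hj]
      exact Finset.sum_eq_zero fun b _ => by rw [ih b (h.2 b), mul_zero]

/-- The reaching probabilities of the histories in an information set, without the contribution of
its owner, add up to at most `1` by perfect recall; so the instantaneous regrets are bounded by the
range of the payoffs. -/
theorem instRegret_mem_Icc {lo D : ℝ} (hD : 0 ≤ D) (σ : Profile A) {i : Fin 2} {s : S i}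
    (a : A i s) (t : Tree A) :
    t.ChanceOK → t.payoffs ⊆ Set.Icc lo (lo + D) → (t.ownSeqs i s).Subsingleton →
      t.instRegret σ i s a ∈ Set.Icc (-D) D := by
  have hzero : (0 : ℝ) ∈ Set.Icc (-D) D := ⟨by linarith, hD⟩
  induction t with
  | terminal u => exact fun _ _ _ => hzero
  | chance n p next ih =>
    intro ht hp hs
    exact (convex_Icc (-D) D).sum_mem (fun o _ => ht.1 o) ht.2.1 fun o _ =>
      ih o (ht.2.2 o) (fun _ hu => hp ⟨o, hu⟩) (hs.anti fun _ hl => ⟨o, hl⟩)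
  | decision j s' next ih =>
    intro ht hp hs
    by_cases hj : j = i
    · subst hj
      by_cases hss : s' = s
      · subst hss
        -- The empty sequence leads to this node, hence no later node lies in the same set.
        have hno : ∀ b, (next b).instRegret σ j s' a = 0 := fun b =>
          instRegret_eq_zero σ a _ fun ⟨l, hl⟩ => by
            have := hs (Or.inl ⟨rfl, rfl⟩) (Or.inr ⟨b, l, hl, rfl⟩)
            simp at this
        rw [instRegret_decision_self, Finset.sum_eq_zero fun b _ => hno b, add_zero, Set.mem_Icc,
          ← abs_le]
        exact abs_valueFor_sub_le σ j (ht a) (fun _ hu => hp ⟨a, hu⟩) ht hp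
      · rw [instRegret_decision_of_infoset_ne _ _ _ _ _ hss]
        by_cases hb : ∃ b, (next b).Occurs j s
        · obtain ⟨b, l, hl⟩ := hb
          rw [Finset.sum_eq_single b]
          · refine ih b (ht b) (fun _ hu => hp ⟨b, hu⟩) fun l₁ h₁ l₂ h₂ => ?_
            have := hs (Or.inr ⟨b, l₁, h₁, rfl⟩) (Or.inr ⟨b, l₂, h₂, rfl⟩)
            simpa using this
          · intro b' _ hb'
            refine instRegret_eq_zero σ a _ fun ⟨l', hl'⟩ => hb' ?_
            have := hs (Or.inr ⟨b', l', hl', rfl⟩) (Or.inr ⟨b, l, hl, rfl⟩)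
            simp only [if_true, List.cons.injEq, Sigma.mk.injEq, heq_eq_eq, true_and] at this
            exact this.1
          · simp
        · rw [Finset.sum_eq_zero fun b _ => instRegret_eq_zero σ a _ fun h => hb ⟨b, h⟩]
          exact hzero
    · rw [instRegret_decision_of_ne _ _ _ _ _ hj]
      exact (convex_Icc (-D) D).sum_mem (fun b _ => (σ j s').2.1 b) (σ j s').2.2 fun b _ =>
        ih b (ht b) (fun _ hu => hp ⟨b, hu⟩)
          (hs.anti fun l hl => Or.inr ⟨b, l, hl, by simp [hj]⟩)

theorem sum_mul_instRegret (σ : Profile A) (i : Fin 2) (s : S i) (t : Tree A) :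
    ∑ a, (σ i s).1 a * t.instRegret σ i s a = 0 := by
  induction t with
  | terminal u => simp [instRegret]
  | chance n p next ih =>
    simp only [instRegret, Finset.mul_sum]
    rw [Finset.sum_comm]
    refine Finset.sum_eq_zero fun o _ => ?_
    simp only [mul_left_comm _ (p o)]
    rw [← Finset.mul_sum, ih, mul_zero]
  | decision j s' next ih =>
    by_cases hj : j = i
    · subst hj
      have hsum : ∑ a, (σ j s).1 a * ∑ b, (next b).instRegret σ j s a = 0 := by
        simp only [Finset.mul_sum]
        rw [Finset.sum_comm]
        exact Finset.sum_eq_zero fun b _ => ih b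
      by_cases hs : s' = s
      · subst hs
        simp only [instRegret_decision_self, mul_add, Finset.sum_add_distrib, hsum, add_zero,
          mul_sub, Finset.sum_sub_distrib]
        rw [← Finset.sum_mul, (σ j s').2.2, one_mul, valueFor_decision, sub_self]
      · simpa only [instRegret_decision_of_infoset_ne _ _ _ _ _ hs] using hsum
    · simp only [instRegret_decision_of_ne _ _ _ _ _ hj, Finset.mul_sum]
      rw [Finset.sum_comm]
      refine Finset.sum_eq_zero fun b _ => ?_
      simp only [mul_left_comm _ ((σ j s').1 b)]
      rw [← Finset.mul_sum, ih, mul_zero]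

/-- The gain of a deviation decomposes over the information sets of the deviating player. Below a
node that the deviation `ρ i` reaches with own probability `w`, each counterfactual regret is
weighted with the own probability `x s` of reaching the information set `s`. -/
theorem mul_valueFor_update_sub [∀ i, Fintype (S i)] (σ ρ : Profile A) (i : Fin 2)
    (x : S i → ℝ) (t : Tree A) :
    ∀ w : ℝ, (∀ s, ∀ l ∈ t.ownSeqs i s,
        w * (l.map fun y => (ρ y.1 y.2.1).1 y.2.2).prod = x s) →
      w * (t.valueFor (Function.update σ i (ρ i)) i - t.valueFor σ i) =
        ∑ y : Σ s, A i s, x y.1 * (ρ i y.1).1 y.2 * t.instRegret σ i y.1 y.2 := by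
  classical
  induction t with
  | terminal u => intro w _; simp [valueFor, value, instRegret]
  | chance n p next ih =>
    intro w hw
    have := fun o => ih o w fun s l hl => hw s l ⟨o, hl⟩
    simp only [valueFor_chance, instRegret, ← Finset.sum_sub_distrib, ← mul_sub, Finset.mul_sum]
    rw [Finset.sum_comm]
    refine Finset.sum_congr rfl fun o _ => ?_
    rw [mul_left_comm, this o, Finset.mul_sum]
    exact Finset.sum_congr rfl fun y _ => by ring
  | decision j s' next ih =>
    intro w hw
    by_cases hj : j = i
    · subst hj
      have hx : w = x s' := by simpa using hw s' [] (Or.inl ⟨rfl, rfl⟩)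
      have h1 := fun b => ih b (w * (ρ j s').1 b) fun s l hl => by
        rw [← hw s (⟨j, s', b⟩ :: l) (Or.inr ⟨b, l, hl, by simp⟩)]
        simp [mul_assoc]
      have hmove : ∀ (b : A j s') (y : Σ s, A j s),
          ((⟨j, s', b⟩ : Move A) = ⟨j, y.1, y.2⟩) = (y = ⟨s', b⟩) := fun b y => by
        simp only [Sigma.mk.injEq, heq_eq_eq, true_and]
        exact propext ⟨fun h => (Sigma.ext h.1 h.2).symm, fun h => by subst h; simp⟩
      simp only [instRegret, if_true, one_mul, Finset.mul_sum, mul_add, Finset.sum_add_distrib]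
      rw [Finset.sum_comm, Finset.sum_comm (s := Finset.univ (α := Σ s, A j s))]
      simp only [hmove, mul_ite, mul_zero, Finset.sum_ite_eq', Finset.mem_univ, if_true, ← h1,
        ← Finset.sum_add_distrib]
      rw [← hx, valueFor_decision (Function.update σ j (ρ j)), Function.update_self, mul_sub,
        Finset.mul_sum]
      have h2 : w * (decision j s' next).valueFor σ j =
          ∑ b, w * (ρ j s').1 b * (decision j s' next).valueFor σ j := by
        rw [← Finset.sum_mul, ← Finset.mul_sum, (ρ j s').2.2, mul_one]
      rw [h2, ← Finset.sum_sub_distrib]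
      exact Finset.sum_congr rfl fun b _ => by ring
    · have h1 := fun b => ih b w fun s l hl => hw s l (Or.inr ⟨b, l, hl, by simp [hj]⟩)
      simp only [valueFor_decision, instRegret_decision_of_ne _ _ _ _ _ hj, Function.update_of_ne hj,
        ← Finset.sum_sub_distrib, ← mul_sub, Finset.mul_sum]
      rw [Finset.sum_comm]
      refine Finset.sum_congr rfl fun b _ => ?_
      rw [mul_left_comm, h1 b, Finset.mul_sum]
      exact Finset.sum_congr rfl fun y _ => by ring

end Tree

variable [∀ i s, Nonempty (A i s)]

theorem cfrRegret_eq_sum (t : Tree A) (n : ℕ) (i : Fin 2) (s : S i) (a : A i s) :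
    cfrRegret t n i s a = ∑ r ∈ Finset.range n, t.instRegret (cfrIterate t r) i s a := by
  induction n with
  | zero => rfl
  | succ n ih => rw [Finset.sum_range_succ, ← ih]; rfl

theorem cfrRegret_le {lo D : ℝ} (hD : 0 ≤ D) {t : Tree A} (ht : t.ChanceOK)
    (hr : t.PerfectRecall) (hp : t.payoffs ⊆ Set.Icc lo (lo + D)) (n : ℕ) (i : Fin 2) (s : S i)
    (a : A i s) : cfrRegret t n i s a ≤ D * √(Fintype.card (A i s) * n) :=
  regret_le_of_regretMatch (R := fun n => cfrRegret t n i s)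
    (r := fun n a => t.instRegret (cfrIterate t n) i s a) rfl (fun _ => rfl)
    (fun n => t.sum_mul_instRegret (cfrIterate t n) i s)
    (fun n a => abs_le.2 (Tree.instRegret_mem_Icc hD (cfrIterate t n) a t ht hp (hr i s))) n a

variable [∀ i, Fintype (S i)]

theorem sum_valueFor_cfrIterate_le {lo D : ℝ} (hD : 0 ≤ D) {t : Tree A} (ht : t.ChanceOK)
    (hr : t.PerfectRecall) (hp : t.payoffs ⊆ Set.Icc lo (lo + D)) (n : ℕ) (i : Fin 2)
    (τ : Strategy A i) :
    ∑ r ∈ Finset.range n, (t.valueFor (Function.update (cfrIterate t r) i τ) i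
        - t.valueFor (cfrIterate t r) i) ≤ D * (t.numInfosets i * √(t.maxActions * n)) := by
  classical
  -- Only the component `ρ i = τ` matters: own sequences consist of moves of player `i`.
  set ρ : Profile A := Function.update (uniformProfile A) i τ with hρ
  have hτ : ρ i = τ := by simp [hρ]
  have hdec : ∀ r, t.valueFor (Function.update (cfrIterate t r) i τ) i
      - t.valueFor (cfrIterate t r) i =
      ∑ y : Σ s, A i s, t.ownReach ρ i y.1 * (τ y.1).1 y.2 *
        t.instRegret (cfrIterate t r) i y.1 y.2 := fun r => by
    have := t.mul_valueFor_update_sub (cfrIterate t r) ρ i (t.ownReach ρ i) 1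
      fun s l hl => by rw [one_mul, Tree.ownReach_eq hr ρ hl]
    rwa [one_mul, hτ] at this
  simp only [hdec]
  rw [Finset.sum_comm]
  simp only [← Finset.mul_sum, ← cfrRegret_eq_sum]
  rw [Fintype.sum_sigma]
  have hs : ∀ s : S i, ∑ a, t.ownReach ρ i s * (τ s).1 a * cfrRegret t n i s a ≤
      if t.Occurs i s then D * √(t.maxActions * n) else 0 := fun s => by
    split_ifs with h
    · have hle : ∀ a, cfrRegret t n i s a ≤ D * √(t.maxActions * n) := fun a =>
        (cfrRegret_le hD ht hr hp n i s a).trans <| by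
          have := Tree.card_le_maxActions h
          gcongr
      calc ∑ a, t.ownReach ρ i s * (τ s).1 a * cfrRegret t n i s a
          ≤ ∑ a, t.ownReach ρ i s * (τ s).1 a * (D * √(t.maxActions * n)) :=
            Finset.sum_le_sum fun a _ => mul_le_mul_of_nonneg_left (hle a)
              (mul_nonneg (t.ownReach_nonneg ρ i s) ((τ s).2.1 a))
        _ = t.ownReach ρ i s * (D * √(t.maxActions * n)) := by
            rw [← Finset.sum_mul, ← Finset.mul_sum, (τ s).2.2, mul_one]
        _ ≤ D * √(t.maxActions * n) :=
            mul_le_of_le_one_left (by positivity) (t.ownReach_le_one ρ i s)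
    · refine (Finset.sum_eq_zero fun a _ => ?_).le
      rw [cfrRegret_eq_sum, Finset.sum_eq_zero fun r _ => Tree.instRegret_eq_zero _ a t h, mul_zero]
  refine (Finset.sum_le_sum fun s _ => hs s).trans (le_of_eq ?_)
  rw [← Finset.sum_filter, Finset.sum_const, nsmul_eq_mul, Tree.numInfosets]
  ring_nf

theorem hasRegretRate_cfr (G : EFG A) {Δ : ℝ}
    (hΔ : ∀ u ∈ G.tree.payoffs, ∀ u' ∈ G.tree.payoffs, u - u' ≤ Δ) :
    HasRegretRate G (cfr G) Δ 0 := by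
  intro P i n τ
  obtain ⟨u, hu⟩ := Tree.payoffs_nonempty G.tree G.chanceOK
  have hD : 0 ≤ Δ := by simpa using hΔ u hu u hu
  have hbdd : BddBelow G.tree.payoffs := ⟨u - Δ, fun v hv => by linarith [hΔ u hu v hv]⟩
  rw [pow_zero, mul_one]
  refine sum_valueFor_cfrIterate_le (lo := sInf G.tree.payoffs) hD
    (P.chanceOK_restrict _ G.chanceOK) (P.perfectRecall_restrict G.perfectRecall)
    ((P.payoffs_restrict_subset _).trans fun v hv => ⟨csInf_le hbdd hv, ?_⟩) n i τ
  have : v - Δ ≤ sInf G.tree.payoffs :=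
    le_csInf ⟨u, hu⟩ fun v' hv' => by linarith [hΔ v hv v' hv']
  linarith

end CFR

/-! ### From regret to approximate equilibria -/

section Nash

variable {S : Fin 2 → Type*} {A : ∀ i, S i → Type*} [∀ i s, Fintype (A i s)]

theorem Tree.valueFor_eq_neg (t : Tree A) (σ : Profile A) {i j : Fin 2} (h : j ≠ i) :
    t.valueFor σ i = -t.valueFor σ j := by
  unfold valueFor
  fin_cases i <;> fin_cases j <;> simp_all

theorem Tree.valueFor_zero_add_one (t : Tree A) (σ : Profile A) :
    t.valueFor σ 0 + t.valueFor σ 1 = 0 := by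
  rw [t.valueFor_eq_neg σ one_ne_zero, neg_add_cancel]

/-- In a zero-sum game, the gains of the two players from best responses bound the distance of a
profile from equilibrium. -/
theorem Tree.isEpsNash_of_isBestResponse {t : Tree A} {σ : Profile A} {ε : ℝ}
    {b : ∀ i (s : S i), A i s} (hb : ∀ i, t.IsBestResponse σ i (b i))
    (h : ∑ i, t.valueFor (Function.update σ i (pureStrategy (b i))) i ≤ ε) :
    t.IsEpsNash ε σ := by
  have key : ∀ i, ∀ τ : Strategy A i,
      t.valueFor (Function.update σ i τ) i - ε ≤ t.valueFor σ i := fun i τ => by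
    have h0 := hb 0 (σ 0)
    have h1 := hb 1 (σ 1)
    rw [Function.update_eq_self] at h0 h1
    rw [Fin.sum_univ_two] at h
    have hz := t.valueFor_zero_add_one σ
    have hi := hb i τ
    fin_cases i <;> simp only [Fin.zero_eta, Fin.mk_one] at * <;> linarith
  refine fun i => ⟨fun j hj τ => ?_, key i⟩
  have := key j τ
  rw [t.valueFor_eq_neg σ hj, t.valueFor_eq_neg _ hj]
  linarith

/-- The average strategy of a restricted game is an approximate equilibrium of the original game if
the regrets are small and the population contains best responses to it. -/
theorem isEpsNash_average (G : EFG A) (P : Population A) (σ : ℕ → Profile P.Act) (d : ℕ) {ε : ℝ}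
    {b : ∀ i (s : S i), A i s}
    (hb : ∀ i, G.tree.IsBestResponse (G.tree.average (fun r => P.extend (σ r)) d) i (b i))
    (hP : ∀ i s, b i s ∈ P.acts i s)
    (hreg : ∀ τ : ∀ i, Strategy P.Act i, ∑ i, ∑ r ∈ Finset.range (d + 1),
      ((P.restrict G.tree).valueFor (Function.update (σ r) i (τ i)) i
        - (P.restrict G.tree).valueFor (σ r) i) ≤ ε * (d + 1)) :
    G.tree.IsEpsNash ε (G.tree.average (fun r => P.extend (σ r)) d) := by
  refine Tree.isEpsNash_of_isBestResponse hb ?_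
  -- The best responses are strategies of the restricted game, so the regrets bound their gains.
  have h := hreg fun i => pureStrategy fun s => ⟨b i s, hP i s⟩
  simp only [Population.valueFor_restrict, Population.extend_update_pureStrategy,
    Finset.sum_sub_distrib, ← Tree.valueFor_average G.perfectRecall] at h
  rw [Finset.sum_comm (s := Finset.univ)] at h
  simp only [Fin.sum_univ_two, Tree.valueFor_zero_add_one, Finset.sum_const_zero, sub_zero] at h
  rw [Fin.sum_univ_two]
  have hd : (0 : ℝ) < d + 1 := by positivity
  refine le_of_mul_le_mul_left ?_ hd
  linarith

end Nash

/-! ### The length of a window -/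

/-- Regret of order `X √(N n)` up to logarithms is at most `ε n` as soon as `n` exceeds
`X² N / ε²` up to logarithms. -/
theorem exists_threshold (K : ℝ) (p : ℕ) :
    ∃ C : ℝ, 0 < C ∧ ∃ n₁ : ℕ, ∀ (X N : ℕ) (ε : ℝ), 0 < ε → ∀ n : ℕ, n₁ ≤ n →
      C * (X ^ 2 * N / ε ^ 2) * Real.log (2 + N * X + 1 / ε) ^ (2 * p) ≤ n →
      K * (X * √(N * n)) * Real.log (2 + X * N * n) ^ p ≤ ε * n := by
  have hlog : ∀ᶠ n : ℕ in Filter.atTop,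
      4 * (K ^ 4 * 2 ^ (4 * p)) * Real.log (1 + n) ^ (4 * p) ≤ 1 + n := by
    have h1 := (Real.isLittleO_pow_log_id_atTop (n := 4 * p)).bound
      (c := (4 * (K ^ 4 * 2 ^ (4 * p)) + 1)⁻¹) (by positivity)
    have h2 : Filter.Tendsto (fun n : ℕ => 1 + (n : ℝ)) Filter.atTop Filter.atTop :=
      Filter.tendsto_atTop_add_const_left _ _ tendsto_natCast_atTop_atTop
    filter_upwards [h2.eventually h1] with n hn
    have hl : 0 ≤ Real.log (1 + n) := Real.log_nonneg (by simp)
    rw [Real.norm_of_nonneg (by positivity), id, Real.norm_of_nonneg (by positivity),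
      inv_mul_eq_div, le_div_iff₀ (by positivity)] at hn
    nlinarith [pow_nonneg hl (4 * p)]
  obtain ⟨n₀, hn₀⟩ := Filter.eventually_atTop.1 hlog
  refine ⟨K ^ 2 * 9 ^ (2 * p) + 1, by positivity, n₀ + 1, fun X N ε hε n hn hC => ?_⟩
  have hn1 : (1 : ℝ) ≤ n := by exact_mod_cast (by omega : 1 ≤ n)
  have hlarge := hn₀ n (by omega)
  set Y : ℝ := 2 + N * X + 1 / ε with hY
  set ℓ : ℝ := Real.log (2 + X * N * n) with hℓ
  set u : ℝ := Real.log (1 + n) with hu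
  set a : ℝ := K ^ 2 * (X ^ 2 * N / ε ^ 2) with ha
  have hε' : 0 < 1 / ε := by positivity
  have hNX : (0 : ℝ) ≤ N * X := by positivity
  have hY2 : 2 ≤ Y := by rw [hY]; linarith
  have hℓ0 : 0 ≤ ℓ := Real.log_nonneg (by
    have : (0 : ℝ) ≤ X * N * n := by positivity
    linarith)
  have hu0 : 0 ≤ u := Real.log_nonneg (by linarith)
  have hL0 : 0 ≤ Real.log Y := Real.log_nonneg (by linarith)
  have ha0 : 0 ≤ a := by positivity
  have hsplit : ℓ ≤ Real.log Y + u := by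
    rw [hℓ, hu, ← Real.log_mul (by linarith) (by linarith)]
    refine Real.log_le_log (by positivity) ?_
    rw [hY]
    have : (0 : ℝ) ≤ 1 / ε * (1 + n) := by positivity
    nlinarith
  have hmain : a * ℓ ^ (2 * p) ≤ n := by
    -- If `n` is polynomial in `Y`, then `ℓ` is of order `log Y`, and `hC` suffices.
    by_cases hcase : u ≤ 8 * Real.log Y
    · have h9 : ℓ ^ (2 * p) ≤ 9 ^ (2 * p) * Real.log Y ^ (2 * p) := by
        rw [← mul_pow]
        exact pow_le_pow_left₀ hℓ0 (by linarith) _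
      calc a * ℓ ^ (2 * p) ≤ a * (9 ^ (2 * p) * Real.log Y ^ (2 * p)) := by gcongr
        _ = K ^ 2 * 9 ^ (2 * p) * (X ^ 2 * N / ε ^ 2) * Real.log Y ^ (2 * p) := by
            rw [ha]; ring
        _ ≤ (K ^ 2 * 9 ^ (2 * p) + 1) * (X ^ 2 * N / ε ^ 2) * Real.log Y ^ (2 * p) := by
            gcongr; linarith
        _ ≤ n := hC
    · -- Here `n` is so large compared with `Y` that `a` is at most of order `√n`.
      push Not at hcase
      have hYn : Y ^ 8 ≤ 1 + n := by
        have h8 : Real.log (Y ^ 8) < Real.log (1 + n) := by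
          rw [Real.log_pow]; push_cast; exact hcase
        exact ((Real.log_lt_log_iff (by positivity) (by linarith)).1 h8).le
      have hℓu : ℓ ≤ 2 * u := by linarith
      have haY : a ≤ K ^ 2 * Y ^ 4 := by
        have h1 : (X : ℝ) ^ 2 * N ≤ Y ^ 2 := by
          have hN : (N : ℝ) ≤ N ^ 2 := by exact_mod_cast Nat.le_self_pow two_ne_zero N
          calc (X : ℝ) ^ 2 * N ≤ (X : ℝ) ^ 2 * (N : ℝ) ^ 2 := by gcongr
            _ = ((N : ℝ) * X) ^ 2 := by ring
            _ ≤ Y ^ 2 := pow_le_pow_left₀ hNX (by rw [hY]; linarith) 2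
        have h2 : (1 / ε) ^ 2 ≤ Y ^ 2 := pow_le_pow_left₀ hε'.le (by rw [hY]; linarith) 2
        calc a = K ^ 2 * (X ^ 2 * N * (1 / ε) ^ 2) := by rw [ha]; field_simp
          _ ≤ K ^ 2 * (Y ^ 2 * Y ^ 2) := by gcongr
          _ = K ^ 2 * Y ^ 4 := by ring
      refine le_of_sq_le_sq ?_ (by positivity)
      calc (a * ℓ ^ (2 * p)) ^ 2 ≤ (K ^ 2 * Y ^ 4 * (2 * u) ^ (2 * p)) ^ 2 := by gcongr
        _ = K ^ 4 * 2 ^ (4 * p) * u ^ (4 * p) * Y ^ 8 := by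
            rw [mul_pow 2 u]; ring
        _ ≤ K ^ 4 * 2 ^ (4 * p) * u ^ (4 * p) * (1 + n) := by gcongr
        _ ≤ (1 + n) / 4 * (1 + n) := by gcongr; linarith
        _ ≤ (n : ℝ) ^ 2 := by nlinarith
  refine le_of_sq_le_sq ?_ (by positivity)
  have hNn : √((N : ℝ) * n) ^ 2 = N * n := Real.sq_sqrt (by positivity)
  calc (K * (X * √(N * n)) * ℓ ^ p) ^ 2
      = ε ^ 2 * n * (a * ℓ ^ (2 * p)) := by
        rw [mul_pow, mul_pow, mul_pow, hNn, ha]; field_simp; ring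
    _ ≤ ε ^ 2 * n * n := by gcongr
    _ = (ε * n) ^ 2 := by ring

/-- The total regret of both players under a regret rate. -/
theorem HasRegretRate.sum_le {S : Fin 2 → Type*} {A : ∀ i, S i → Type*} [∀ i, Fintype (S i)]
    [∀ i s, Fintype (A i s)] {G : EFG A} {alg : Minimizer A} {K : ℝ} {p : ℕ}
    (h : HasRegretRate G alg K p) (P : Population A) {X : ℕ} (hX : (P.restrict G.tree).size ≤ X)
    (n : ℕ) (τ : ∀ i, Strategy P.Act i) :
    ∑ i, ∑ r ∈ Finset.range n,
        ((P.restrict G.tree).valueFor (Function.update (alg P r) i (τ i)) i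
          - (P.restrict G.tree).valueFor (alg P r) i) ≤
      |K| * (X * √(G.tree.maxActions * n)) * Real.log (2 + X * G.tree.maxActions * n) ^ p := by
  have hN := P.maxActions_restrict_le G.tree
  set t := P.restrict G.tree with ht
  calc _ ≤ ∑ i, |K| * (t.numInfosets i * √(G.tree.maxActions * n)) *
        Real.log (2 + X * G.tree.maxActions * n) ^ p := by
        refine Finset.sum_le_sum fun i _ => (h P i n (τ i)).trans ?_
        have hi : t.numInfosets i ≤ X :=
          (Finset.single_le_sum (fun _ _ => Nat.zero_le _) (Finset.mem_univ i)).trans hX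
        have h0 : (0 : ℝ) ≤ t.numInfosets i * t.maxActions * n := by positivity
        have hl : 0 ≤ Real.log (2 + t.numInfosets i * t.maxActions * n) :=
          Real.log_nonneg (by linarith)
        have hle : Real.log (2 + t.numInfosets i * t.maxActions * n) ≤
            Real.log (2 + X * G.tree.maxActions * n) :=
          Real.log_le_log (by positivity) (by gcongr)
        have hK := le_abs_self K
        gcongr
    _ = |K| * (t.size * √(G.tree.maxActions * n)) *
        Real.log (2 + X * G.tree.maxActions * n) ^ p := by
        rw [← Finset.sum_mul, ← Finset.mul_sum, ← Finset.sum_mul, Tree.size]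
        push_cast
        rfl
    _ ≤ _ := by
        have hl : 0 ≤ Real.log (2 + X * G.tree.maxActions * n) := Real.log_nonneg (by
          have : (0 : ℝ) ≤ X * G.tree.maxActions * n := by positivity
          linarith)
        gcongr

/-! ### The run of the algorithm -/

section Run

variable {S : Fin 2 → Type*} {A : ∀ i, S i → Type*}

theorem Population.mem_acts_of_merge_eq {P : Population A} {b : ∀ i (s : S i), A i s}
    (h : P.merge b = P) (i : Fin 2) (s : S i) : b i s ∈ P.acts i s := by
  classical
  rw [← h]
  simp [merge]

theorem Population.acts_subset_merge (P : Population A) (b : ∀ i (s : S i), A i s) (i : Fin 2)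
    (s : S i) : P.acts i s ⊆ (P.merge b).acts i s := by
  classical
  exact Finset.subset_union_left

section Total

variable [∀ i, Fintype (S i)]

/-- The total number of actions in a population. -/
def Population.total (P : Population A) : ℕ := ∑ x : Σ i, S i, (P.acts x.1 x.2).card

theorem Population.total_lt_total_merge {P : Population A} {b : ∀ i (s : S i), A i s}
    (h : P.merge b ≠ P) : P.total < (P.merge b).total := by
  classical
  by_contra hlt
  have hle : ∀ x ∈ Finset.univ (α := Σ i, S i),
      (P.acts x.1 x.2).card ≤ ((P.merge b).acts x.1 x.2).card :=
    fun x _ => Finset.card_le_card (P.acts_subset_merge b x.1 x.2)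
  have heq := (Finset.sum_eq_sum_iff_of_le hle).1
    (le_antisymm (Finset.sum_le_sum hle) (not_lt.1 hlt))
  refine h (Population.ext (funext fun i => funext fun s => ?_))
  exact (Finset.eq_of_subset_of_card_le (P.acts_subset_merge b i s)
    (heq ⟨i, s⟩ (Finset.mem_univ _)).ge).symm

theorem Population.total_le [∀ i s, Fintype (A i s)] (P : Population A) :
    P.total ≤ ∑ x : Σ i, S i, Fintype.card (A x.1 x.2) :=
  Finset.sum_le_sum fun _ _ => Finset.card_le_univ _

end Total

variable [∀ i s, Fintype (A i s)] [∀ i s, Nonempty (A i s)]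
variable (G : EFG A) (alg : Minimizer A) (β : BestResponder G) (m : ℕ → ℕ+)

/-- Either a new window starts, or the window goes on; the latter happens at a best-response
computation only if the best responses are already in the population. -/
theorem rmdo_step (t : ℕ) :
    let x := rmdo G alg β m (t + 1)
    let b := β.br (t + 1) (lastWindowAverage G alg β m (t + 1))
    (rmdo G alg β m (t + 2) = ⟨x.pop.merge b, x.window + 1, 0⟩ ∧ x.pop.merge b ≠ x.pop) ∨
    (rmdo G alg β m (t + 2) = ⟨x.pop, x.window, x.done + 1⟩ ∧
      ((t + 1) % (m x.window : ℕ) = 0 → ∀ i s, b i s ∈ x.pop.acts i s)) := by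
  intro x b
  by_cases h : (t + 1) % (m x.window : ℕ) = 0 ∧ x.pop.merge b ≠ x.pop
  · exact Or.inl ⟨if_pos h, h.2⟩
  · refine Or.inr ⟨if_neg h, fun hm => ?_⟩
    exact Population.mem_acts_of_merge_eq (not_not.1 fun hne => h ⟨hm, hne⟩)

theorem window_le_total [∀ i, Fintype (S i)] (t : ℕ) :
    (rmdo G alg β m (t + 1)).window ≤ (rmdo G alg β m (t + 1)).pop.total := by
  induction t with
  | zero => exact Nat.zero_le _
  | succ t ih =>
    rcases rmdo_step G alg β m t with ⟨h, hne⟩ | ⟨h, -⟩ <;> rw [h]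
    · exact ih.trans_lt (Population.total_lt_total_merge hne)
    · exact ih

theorem gameSize_mono [∀ i, Fintype (S i)] {t u : ℕ} (h : t ≤ u) :
    gameSize G alg β m (t + 1) ≤ gameSize G alg β m (u + 1) := by
  refine monotone_nat_of_le_succ (f := fun t => gameSize G alg β m (t + 1)) (fun t => ?_) h
  unfold gameSize
  rcases rmdo_step G alg β m t with ⟨h, -⟩ | ⟨h, -⟩ <;> rw [h]
  exact Population.size_restrict_mono (Population.acts_subset_merge _ _) _

/-- If, at each best-response computation that leaves the population unchanged, fewer than `n₀`
iterations of the window have been made, then every window has at most `n₀ + c` iterations. -/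
theorem iterations_le (c : ℕ+) (n₀ t : ℕ)
    (h : ∀ u < t, (u + 1) % (c : ℕ) = 0 →
      (∀ i s, β.br (u + 1) (lastWindowAverage G alg β (periodic c) (u + 1)) i s ∈
        (rmdo G alg β (periodic c) (u + 1)).pop.acts i s) →
      (rmdo G alg β (periodic c) (u + 1)).done + 1 < n₀) :
    t + 1 ≤ ((rmdo G alg β (periodic c) (t + 1)).window + 1) * (n₀ + c) := by
  -- `t % c` counts the iterations since the last best-response computation.
  suffices hinv : (rmdo G alg β (periodic c) (t + 1)).done ≤ n₀ + t % c ∧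
      t + 1 ≤ (rmdo G alg β (periodic c) (t + 1)).window * (n₀ + c) +
        (rmdo G alg β (periodic c) (t + 1)).done + 1 by
    have := Nat.mod_lt t c.pos
    rw [Nat.succ_mul]
    omega
  induction t with
  | zero => exact ⟨Nat.zero_le _, by simp⟩
  | succ t ih =>
    obtain ⟨ih₁, ih₂⟩ := ih fun u hu => h u (hu.trans (Nat.lt_succ_self t))
    have hlt := Nat.mod_lt t c.pos
    rcases rmdo_step G alg β (periodic c) t with ⟨hx, -⟩ | ⟨hx, hb⟩ <;> rw [hx]
    · refine ⟨Nat.zero_le _, ?_⟩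
      dsimp only
      rw [Nat.succ_mul]
      omega
    · refine ⟨?_, by dsimp only; omega⟩
      dsimp only
      by_cases hc : (t + 1) % (c : ℕ) = 0
      · have := h t (Nat.lt_succ_self t) hc (hb hc)
        omega
      · have h1 : (t % c + 1) % (c : ℕ) = (t + 1) % c := Nat.mod_add_mod t c 1
        have h2 : t % c + 1 ≠ (c : ℕ) := fun h2 => hc (by rw [← h1, h2, Nat.mod_self])
        rw [Nat.mod_eq_of_lt (by omega)] at h1
        omega

theorem samples_le [∀ i, Fintype (S i)] (c : ℕ+) (t : ℕ) :
    samples G alg β (periodic c) (t + 1) ≤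
      (t + 1) * gameSize G alg β (periodic c) (t + 1) +
        (t + 1) / c * gameSize G alg β (periodic c) (t + 1) := by
  have hle : ∀ u ∈ Finset.Icc 1 (t + 1),
      gameSize G alg β (periodic c) u ≤ gameSize G alg β (periodic c) (t + 1) := fun u hu => by
    rw [Finset.mem_Icc] at hu
    obtain ⟨v, rfl⟩ := Nat.exists_eq_add_of_le' hu.1
    exact gameSize_mono G alg β (periodic c) (by omega)
  refine add_le_add ?_ ?_
  · refine (Finset.sum_le_card_nsmul _ _ _ hle).trans (by simp)
  · refine (Finset.sum_le_card_nsmul _ _ _ fun u hu => hle u (Finset.mem_of_mem_filter u hu)).trans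
      (le_of_eq ?_)
    rw [smul_eq_mul, ← Nat.Ioc_filter_dvd_card_eq_div]
    simp only [periodic, Nat.dvd_iff_mod_eq_zero]
    rfl

end Run

/-! ### Sample complexity -/

/-- A regret rate with logarithmic exponent `p` costs a logarithmic factor with exponent `2 * p`;
in particular none if `p = 0`. -/
theorem exists_samples_le (K : ℝ) (p : ℕ) : ∃ C : ℝ, 0 < C ∧
    ∀ {S : Fin 2 → Type*} {A : ∀ i, S i → Type*} [∀ i, Fintype (S i)] [∀ i s, Fintype (A i s)]
      [∀ i s, Nonempty (A i s)] (G : EFG A) (alg : Minimizer A) (_ : HasRegretRate G alg K p)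
      (β : BestResponder G) (c : ℕ+) (ε : ℝ) (_ : 0 < ε),
      ∃ (T k X N : ℕ),
        FirstReaches G alg β (periodic c) ε T ∧
        k = numWindows G alg β (periodic c) T ∧
        X = gameSize G alg β (periodic c) T ∧
        N = G.tree.maxActions ∧
        (samples G alg β (periodic c) T : ℝ) ≤
          C * (k * N * X ^ 3 / ε ^ 2 + c * k * X + k * N * X ^ 3 / (c * ε ^ 2))
            * Real.log (2 + N * X + 1 / ε) ^ (2 * p) := by
  obtain ⟨C, hC, n₁, hthr⟩ := exists_threshold |K| p
  have hlog2 : 0 < Real.log 2 := Real.log_pos one_lt_two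
  -- The term `2 * (n₁ + 2)` pays for the `n₁ + c` iterations of a window beyond its regret bound;
  -- `log 2` is a lower bound of the logarithm in the claim.
  refine ⟨C + 2 * (n₁ + 2) / Real.log 2 ^ (2 * p), by positivity,
    fun {S A} _ _ _ G alg halg β c ε hε => ?_⟩
  set N := G.tree.maxActions
  -- A window of `n₀ X` iterations has regret at most `ε` per iteration, if the size is at most `X`.
  let B : ℕ → ℝ := fun X => C * (X ^ 2 * N / ε ^ 2) * Real.log (2 + N * X + 1 / ε) ^ (2 * p)
  let n₀ : ℕ → ℕ := fun X => ⌈B X⌉₊ + n₁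
  have hnash : ∀ X t, gameSize G alg β (periodic c) (t + 1) ≤ X →
      (∀ i s, β.br (t + 1) (lastWindowAverage G alg β (periodic c) (t + 1)) i s ∈
        (rmdo G alg β (periodic c) (t + 1)).pop.acts i s) →
      n₀ X ≤ (rmdo G alg β (periodic c) (t + 1)).done + 1 →
      G.tree.IsEpsNash ε (lastWindowAverage G alg β (periodic c) (t + 1)) := by
    intro X t hX hb hn
    refine isEpsNash_average G _ _ _ (fun i => β.isBestResponse (t + 1) _ i) hb fun τ => ?_
    refine (halg.sum_le _ hX _ τ).trans ?_
    have hn' : B X ≤ ((rmdo G alg β (periodic c) (t + 1)).done + 1 : ℕ) :=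
      (Nat.le_ceil _).trans (by exact_mod_cast (Nat.le_add_right _ _).trans hn)
    have := hthr X N ε hε _ ((Nat.le_add_left _ _).trans hn) hn'
    push_cast at this ⊢
    exact this
  have hbound : ∀ X t, gameSize G alg β (periodic c) (t + 1) ≤ X →
      (∀ u < t, ¬ G.tree.IsEpsNash ε (lastWindowAverage G alg β (periodic c) (u + 1))) →
      t + 1 ≤ ((rmdo G alg β (periodic c) (t + 1)).window + 1) * (n₀ X + c) := by
    intro X t hX hno
    refine iterations_le G alg β c (n₀ X) t fun u hu _ hb => not_le.1 fun hle => hno u hu ?_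
    exact hnash X u ((gameSize_mono G alg β _ hu.le).trans hX) hb hle
  have hex : {t | 1 ≤ t ∧
      G.tree.IsEpsNash ε (lastWindowAverage G alg β (periodic c) t)}.Nonempty := by
    -- Otherwise the run is infinite, but finitely many windows have bounded total length.
    by_contra hempty
    have hno : ∀ u, ¬ G.tree.IsEpsNash ε (lastWindowAverage G alg β (periodic c) (u + 1)) :=
      fun u hu => hempty ⟨u + 1, Nat.le_add_left 1 u, hu⟩
    set M := ∑ x : Σ i, S i, Fintype.card (A x.1 x.2)
    have h1 := hbound G.tree.size ((M + 1) * (n₀ G.tree.size + c))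
      (Population.size_restrict_le _ _) fun u _ => hno u
    have h2 := (window_le_total G alg β (periodic c)
      ((M + 1) * (n₀ G.tree.size + c))).trans (Population.total_le _)
    have h3 := Nat.mul_le_mul_right (n₀ G.tree.size + c) (Nat.succ_le_succ h2)
    exact absurd (h1.trans h3) (by simp [M])
  obtain ⟨T, hT⟩ : ∃ T, FirstReaches G alg β (periodic c) ε T :=
    ⟨_, Nat.sInf_mem hex, fun _ h => Nat.sInf_le h⟩
  refine ⟨T, _, _, _, hT, rfl, rfl, rfl, ?_⟩
  obtain ⟨t, rfl⟩ := Nat.exists_eq_add_of_le' hT.1.1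
  set X := gameSize G alg β (periodic c) (t + 1)
  set k := numWindows G alg β (periodic c) (t + 1)
  set Λ := Real.log (2 + N * X + 1 / ε) ^ (2 * p) with hΛ
  have htk : t + 1 ≤ k * (n₀ X + c) := hbound X t le_rfl fun u hu hnash' => by
    have := hT.2 ⟨Nat.le_add_left 1 u, hnash'⟩
    omega
  have hΛ2 : Real.log 2 ^ (2 * p) ≤ Λ := by
    refine pow_le_pow_left₀ hlog2.le (Real.log_le_log two_pos ?_) _
    have h1 : (0 : ℝ) ≤ N * X := by positivity
    have h2 : 0 < 1 / ε := by positivity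
    linarith
  have hΛ0 : 0 ≤ Λ := (pow_pos hlog2 _).le.trans hΛ2
  have hc : (1 : ℝ) ≤ c := by exact_mod_cast c.pos
  have hB0 : 0 ≤ B X := by
    have : B X = C * (X ^ 2 * N / ε ^ 2) * Λ := rfl
    rw [this]
    positivity
  have hT1 : ((t + 1 : ℕ) : ℝ) ≤ k * (B X + (n₁ + 1) + c) := by
    calc ((t + 1 : ℕ) : ℝ) ≤ ((k * (n₀ X + c) : ℕ) : ℝ) := by exact_mod_cast htk
      _ = k * (⌈B X⌉₊ + n₁ + c) := by push_cast [n₀]; rfl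
      _ ≤ k * (B X + (n₁ + 1) + c) := by
          have := (Nat.ceil_lt_add_one hB0).le
          exact mul_le_mul_of_nonneg_left (by linarith) k.cast_nonneg
  have hdiv : (((t + 1) / c : ℕ) : ℝ) ≤ k * (B X / c + (n₁ + 2)) := by
    calc (((t + 1) / c : ℕ) : ℝ) ≤ ((t + 1 : ℕ) : ℝ) / c := Nat.cast_div_le
      _ ≤ k * (B X + (n₁ + 1) + c) / c := by gcongr
      _ = k * (B X / c + ((n₁ + 1) / c + 1)) := by field_simp; ring
      _ ≤ k * (B X / c + (n₁ + 2)) := by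
          have : ((n₁ : ℝ) + 1) / c ≤ n₁ + 1 := div_le_self (by positivity) hc
          exact mul_le_mul_of_nonneg_left (by linarith) k.cast_nonneg
  have hone : 1 ≤ Λ / Real.log 2 ^ (2 * p) := (one_le_div (by positivity)).2 hΛ2
  calc (samples G alg β (periodic c) (t + 1) : ℝ)
      ≤ ((t + 1 : ℕ) : ℝ) * X + (((t + 1) / c : ℕ) : ℝ) * X := by
        exact_mod_cast samples_le G alg β c t
    _ ≤ k * (B X + (n₁ + 1) + c) * X + k * (B X / c + (n₁ + 2)) * X := by gcongr
    _ = C * (k * N * X ^ 3 / ε ^ 2 + k * N * X ^ 3 / (c * ε ^ 2)) * Λ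
        + k * X * ((n₁ + 1) + c + (n₁ + 2)) := by
        have : B X = C * (X ^ 2 * N / ε ^ 2) * Λ := rfl
        rw [this]
        field_simp
        ring
    _ ≤ C * (k * N * X ^ 3 / ε ^ 2 + k * N * X ^ 3 / (c * ε ^ 2)) * Λ
        + k * X * (2 * (n₁ + 2) * c) * (Λ / Real.log 2 ^ (2 * p)) := by
        have h1 : ((n₁ : ℝ) + 1) + c + (n₁ + 2) ≤ 2 * (n₁ + 2) * c := by
          nlinarith [mul_le_mul_of_nonneg_left hc (by positivity : (0 : ℝ) ≤ 2 * n₁ + 3)]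
        have h2 : (k : ℝ) * X * ((n₁ + 1) + c + (n₁ + 2)) ≤ k * X * (2 * (n₁ + 2) * c) := by
          gcongr
        exact add_le_add le_rfl (h2.trans (le_mul_of_one_le_right (by positivity) hone))
    _ ≤ C * (k * N * X ^ 3 / ε ^ 2 + k * N * X ^ 3 / (c * ε ^ 2)) * Λ
        + k * X * (2 * (n₁ + 2) * c) * (Λ / Real.log 2 ^ (2 * p))
        + (C * (c * k * X) * Λ + 2 * (n₁ + 2) / Real.log 2 ^ (2 * p) *
          (k * N * X ^ 3 / ε ^ 2 + k * N * X ^ 3 / (c * ε ^ 2)) * Λ) :=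
        le_add_of_nonneg_right (by positivity)
    _ = (C + 2 * (n₁ + 2) / Real.log 2 ^ (2 * p)) *
        (k * N * X ^ 3 / ε ^ 2 + c * k * X + k * N * X ^ 3 / (c * ε ^ 2)) * Λ := by
        ring

end DoubleOracle

theorem mainTheorem6 :
    (∀ Δ : ℝ, ∃ C : ℝ, 0 < C ∧
      ∀ {S : Fin 2 → Type*} {A : ∀ i, S i → Type*} [∀ i, Fintype (S i)] [∀ i s, Fintype (A i s)]
        [∀ i s, Nonempty (A i s)] (G : DoubleOracle.EFG A)
        (_ : ∀ u ∈ G.tree.payoffs, ∀ u' ∈ G.tree.payoffs, u - u' ≤ Δ)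
        (β : DoubleOracle.BestResponder G) (c : ℕ+) (_ : 1 < c) (ε : ℝ) (_ : 0 < ε),
        ∃ (T k X N : ℕ),
          DoubleOracle.FirstReaches G (DoubleOracle.cfr G) β (DoubleOracle.periodic c) ε T ∧
          k = DoubleOracle.numWindows G (DoubleOracle.cfr G) β (DoubleOracle.periodic c) T ∧
          X = DoubleOracle.gameSize G (DoubleOracle.cfr G) β (DoubleOracle.periodic c) T ∧
          N = G.tree.maxActions ∧
          (DoubleOracle.samples G (DoubleOracle.cfr G) β (DoubleOracle.periodic c) T : ℝ) ≤
            C * (k * N * X ^ 3 / ε ^ 2 + c * k * X + k * N * X ^ 3 / (c * ε ^ 2))) ∧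
    (∀ (K : ℝ) (p : ℕ), ∃ (C : ℝ) (q : ℕ), 0 < C ∧
      ∀ {S : Fin 2 → Type*} {A : ∀ i, S i → Type*} [∀ i, Fintype (S i)] [∀ i s, Fintype (A i s)]
        [∀ i s, Nonempty (A i s)] (G : DoubleOracle.EFG A) (alg : DoubleOracle.Minimizer A)
        (_ : DoubleOracle.HasRegretRate G alg K p)
        (β : DoubleOracle.BestResponder G) (c : ℕ+) (_ : 1 < c) (ε : ℝ) (_ : 0 < ε),
        ∃ (T k X N : ℕ),
          DoubleOracle.FirstReaches G alg β (DoubleOracle.periodic c) ε T ∧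
          k = DoubleOracle.numWindows G alg β (DoubleOracle.periodic c) T ∧
          X = DoubleOracle.gameSize G alg β (DoubleOracle.periodic c) T ∧
          N = G.tree.maxActions ∧
          (DoubleOracle.samples G alg β (DoubleOracle.periodic c) T : ℝ) ≤
            C * (k * N * X ^ 3 / ε ^ 2 + c * k * X + k * N * X ^ 3 / (c * ε ^ 2))
              * Real.log (2 + N * X + 1 / ε) ^ q) := by
  refine ⟨fun Δ => ?_, fun K p => ?_⟩
  · obtain ⟨C, hC, h⟩ := DoubleOracle.exists_samples_le Δ 0
    refine ⟨C, hC, fun G hΔ β c _ ε hε => ?_⟩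
    simpa using h G _ (DoubleOracle.hasRegretRate_cfr G hΔ) β c ε hε
  · obtain ⟨C, hC, h⟩ := DoubleOracle.exists_samples_le K p
    exact ⟨C, 2 * p, hC, fun G alg halg β c _ ε hε => h G alg halg β c ε hε⟩
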